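/- Let $f,g:\mathbb R^n\to\mathbb R\cup\{+\infty\}$ be proper, convex and lower semicontinuous, and let $Y\subseteq\mathbb R^n$ be closed and convex with $\operatorname{dom}(g)\subseteq Y\subseteq\operatorname{dom}(f)$. Assume that $f$ is differentiable on $Y$ with Lipschitz continuous gradient $\nabla f$ on $Y$ (it suffices that $\nabla f$ is a Lipschitz map that is at each point of $Y$ a gradient of $f$ relative to $Y$), that $g$ is bounded from below, and that $F=f+g$ has a minimizer over $\mathbb R^n$. For a symmetric positive definite matrix $D$ put $\|u\|_D^2=u^TDu$, $P_{Y,D}(x)=\operatorname{argmin}_{y\in Y}\|y-x\|_D^2$, $\ell(z;x)=f(x)+\nabla f(x)^T(z-x)$ and, for $\alpha>0$ and $x\in Y$, $p_{\alpha,D}(x)=\operatorname{argmin}_{z\in\mathbb R^n}\bigl\{\ell(z;x)+g(z)+\tfrac1{2\alpha}\|x-z\|_D^2\bigr\}$. For symmetric matrices, $A\preceq B$ means that $B-A$ is positive semidefinite. Let $\eta>0$ and let $(D_k)_{k\ge0}$ be symmetric positive definite matrices with $D_k\succeq\eta I$ for all $k$ and $\sup_k\|D_k\|<\infty$. Assume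 that there are real numbers $\eta_k,\nu_k\ge0$ with $$D_{k+1}\preceq(1+\eta_k)D_k,\qquad D_k\preceq(1+\nu_k)D_{k+1}\qquad\text{for all }k\ge0,$$ and $\eta_k=O(1/k^p)$, $\nu_k=O(1/k^p)$ for some $p>2$. Let $a>2$, $\beta_0=0$ and $\beta_k=\frac{k-1}{k+a}$ for $k\ge1$. Let $\bar\alpha>0$, $0<\delta<1$, $x^{(0)}\in Y$, and set $x^{(-1)}=x^{(0)}$, $\alpha_{-1}=\bar\alpha$. For $k=0,1,2,\dots$ let $$y^{(k)}=P_{Y,D_k}\bigl(x^{(k)}+\beta_k(x^{(k)}-x^{(k-1)})\bigr),\qquad \alpha_k=\delta^{i_k}\alpha_{k-1},\qquad x^{(k+1)}=p_{\alpha_k,D_k}(y^{(k)}),$$ where $i_k\ge0$ is the least integer $i$ such that, with $\alpha=\delta^{i}\alpha_{k-1}$ and $z=p_{\alpha,D_k}(y^{(k)})$, $$f(z)\le \ell(z;y^{(k)})+\tfrac1{2\alpha}\|y^{(k)}-z\|_{D_k}^2 .$$ Then the whole sequence $(x^{(k)})$ converges to a minimizer of $F$ over $\mathbb R^n$. -/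

import Mathlib

namespace VMFB

/-- The effective domain of an extended-real-valued function. -/
def dom {E : Type*} (f : E → EReal) : Set E := {x | f x < ⊤}

/-- A function with values in `ℝ ∪ {+∞}` that is not identically `+∞`. -/
def IsProper {E : Type*} (f : E → EReal) : Prop :=
  (∀ x, f x ≠ ⊥) ∧ (dom f).Nonempty

/-- Convexity of an extended-real-valued function: its epigraph is convex. -/
def IsConvex {E : Type*} [AddCommGroup E] [Module ℝ E] (f : E → EReal) : Prop :=
  Convex ℝ {q : E × ℝ | f q.1 ≤ (q.2 : EReal)}

/-- `A ⪯ B` in the Loewner order: `B - A` is symmetric positive semidefinite. -/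
def LoewnerLE {n : ℕ} (A B : Matrix (Fin n) (Fin n) ℝ) : Prop := (B - A).PosSemidef

/-- The set of symmetric positive definite matrices `D` with `D ⪰ η I`. -/
def metricSet (n : ℕ) (η : ℝ) : Set (Matrix (Fin n) (Fin n) ℝ) :=
  {D | D.PosDef ∧ LoewnerLE (η • (1 : Matrix (Fin n) (Fin n) ℝ)) D}

/-- The operator norm of a matrix induced by the Euclidean vector norm. -/
noncomputable def opNorm {n : ℕ} (D : Matrix (Fin n) (Fin n) ℝ) : ℝ :=
  ‖Matrix.toEuclideanCLM (n := Fin n) (𝕜 := ℝ) D‖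

/-- The squared norm `‖u‖_D² = uᵀ D u`. -/
noncomputable def sqNorm {n : ℕ} (D : Matrix (Fin n) (Fin n) ℝ)
    (u : EuclideanSpace ℝ (Fin n)) : ℝ :=
  inner ℝ u (Matrix.toEuclideanCLM (n := Fin n) (𝕜 := ℝ) D u)

/-- A minimizer of `φ` over `S` (an arbitrary point if there is none). -/
noncomputable def argmin {E : Type*} [Nonempty E] (φ : E → EReal) (S : Set E) : E :=
  Classical.epsilon fun y => y ∈ S ∧ ∀ z ∈ S, φ y ≤ φ z

/-- The projection `P_{Y,D}(x) = argmin_{y ∈ Y} ‖y - x‖_D²`. -/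
noncomputable def proj {n : ℕ} (Y : Set (EuclideanSpace ℝ (Fin n)))
    (D : Matrix (Fin n) (Fin n) ℝ) (x : EuclideanSpace ℝ (Fin n)) :
    EuclideanSpace ℝ (Fin n) :=
  argmin (fun y => ((sqNorm D (y - x) : ℝ) : EReal)) Y

/-- The linearization `ℓ(z; x) = f(x) + ∇f(x)ᵀ(z - x)`. -/
noncomputable def lin {n : ℕ} (f : EuclideanSpace ℝ (Fin n) → EReal)
    (gradf : EuclideanSpace ℝ (Fin n) → EuclideanSpace ℝ (Fin n))
    (z x : EuclideanSpace ℝ (Fin n)) : EReal :=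
  f x + ((inner ℝ (gradf x) (z - x) : ℝ) : EReal)

/-- The model `Q_{α,D}(z; x) = ℓ(z; x) + g(z) + ‖x - z‖_D² / (2α)`. -/
noncomputable def model {n : ℕ} (f g : EuclideanSpace ℝ (Fin n) → EReal)
    (gradf : EuclideanSpace ℝ (Fin n) → EuclideanSpace ℝ (Fin n))
    (α : ℝ) (D : Matrix (Fin n) (Fin n) ℝ) (z x : EuclideanSpace ℝ (Fin n)) : EReal :=
  lin f gradf z x + g z + ((1 / (2 * α) * sqNorm D (x - z) : ℝ) : EReal)

/-- The scaled forward-backward operator `p_{α,D}(x) = argmin_z Q_{α,D}(z; x)`. -/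
noncomputable def fbStep {n : ℕ} (f g : EuclideanSpace ℝ (Fin n) → EReal)
    (gradf : EuclideanSpace ℝ (Fin n) → EuclideanSpace ℝ (Fin n))
    (α : ℝ) (D : Matrix (Fin n) (Fin n) ℝ) (x : EuclideanSpace ℝ (Fin n)) :
    EuclideanSpace ℝ (Fin n) :=
  argmin (fun z => model f g gradf α D z x) Set.univ

/-- The backtracking test for the trial step length `α` at the extrapolated point `y`:
with `z = p_{α,D}(y)`, it holds that `f(z) ≤ ℓ(z; y) + ‖y - z‖_D² / (2α)`. -/
def Accepts {n : ℕ} (f g : EuclideanSpace ℝ (Fin n) → EReal)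
    (gradf : EuclideanSpace ℝ (Fin n) → EuclideanSpace ℝ (Fin n))
    (D : Matrix (Fin n) (Fin n) ℝ) (y : EuclideanSpace ℝ (Fin n)) (α : ℝ) : Prop :=
  f (fbStep f g gradf α D y) ≤ lin f gradf (fbStep f g gradf α D y) y +
    ((1 / (2 * α) * sqNorm D (y - fbStep f g gradf α D y) : ℝ) : EReal)

/-- The result `δ ^ i * α` of backtracking from `α`, where `i` is the number of reductions
made, that is, the least `i` for which the trial step length `δ ^ i * α` passes the test. -/
noncomputable def backtrack {n : ℕ} (f g : EuclideanSpace ℝ (Fin n) → EReal)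
    (gradf : EuclideanSpace ℝ (Fin n) → EuclideanSpace ℝ (Fin n))
    (δ : ℝ) (D : Matrix (Fin n) (Fin n) ℝ) (y : EuclideanSpace ℝ (Fin n)) (α : ℝ) : ℝ :=
  δ ^ sInf {i : ℕ | Accepts f g gradf D y (δ ^ i * α)} * α

/-- What the algorithm remembers when its `k`-th iteration starts:
`x^{(k-1)}`, `x^{(k)}` and `α_{k-1}`. -/
structure State (n : ℕ) where
  prev : EuclideanSpace ℝ (Fin n)
  cur : EuclideanSpace ℝ (Fin n)
  step : ℝ

/-- The scaled inertial forward-backward method with backtracking. It starts from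
`x^{(-1)} = x^{(0)} = x₀` and the initial step length `α₀`. -/
noncomputable def state {n : ℕ} (f g : EuclideanSpace ℝ (Fin n) → EReal)
    (gradf : EuclideanSpace ℝ (Fin n) → EuclideanSpace ℝ (Fin n))
    (Y : Set (EuclideanSpace ℝ (Fin n))) (β : ℕ → ℝ) (D : ℕ → Matrix (Fin n) (Fin n) ℝ)
    (δ α₀ : ℝ) (x₀ : EuclideanSpace ℝ (Fin n)) : ℕ → State n
  | 0 => ⟨x₀, x₀, α₀⟩
  | k + 1 =>
    let s := state f g gradf Y β D δ α₀ x₀ k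
    let y := proj Y (D k) (s.cur + β k • (s.cur - s.prev))
    let α := backtrack f g gradf δ (D k) y s.step
    ⟨s.cur, fbStep f g gradf α (D k) y, α⟩

/-- The iterate `x^{(k)}` of the method. -/
noncomputable def iterate {n : ℕ} (f g : EuclideanSpace ℝ (Fin n) → EReal)
    (gradf : EuclideanSpace ℝ (Fin n) → EuclideanSpace ℝ (Fin n))
    (Y : Set (EuclideanSpace ℝ (Fin n))) (β : ℕ → ℝ) (D : ℕ → Matrix (Fin n) (Fin n) ℝ)
    (δ α₀ : ℝ) (x₀ : EuclideanSpace ℝ (Fin n)) (k : ℕ) : EuclideanSpace ℝ (Fin n) :=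
  (state f g gradf Y β D δ α₀ x₀ k).cur

/-- The parameters `θ_0 = 1`, `θ_k = a / (k + a)` for `k ≥ 1`. -/
noncomputable def theta (a : ℝ) (k : ℕ) : ℝ := if k = 0 then 1 else a / (k + a)

/-- The extrapolation parameters `β_0 = 0`, `β_k = (k - 1) / (k + a)` for `k ≥ 1`. -/
noncomputable def beta (a : ℝ) (k : ℕ) : ℝ := if k = 0 then 0 else ((k : ℝ) - 1) / (k + a)

/-- The two families of parameters are linked by `β_k = θ_k (1 - θ_{k-1}) / θ_{k-1}`. -/
theorem beta_succ_eq {a : ℝ} (ha : 0 < a) (k : ℕ) :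
    beta a (k + 1) = theta a (k + 1) * (1 - theta a k) / theta a k := by
  have h1 : (k : ℝ) + 1 + a ≠ 0 := by positivity
  have h2 : (k : ℝ) + a ≠ 0 := by positivity
  rcases Nat.eq_zero_or_pos k with rfl | hk
  · simp [beta, theta]
  · have hk' : k ≠ 0 := hk.ne'
    simp only [beta, theta, hk', Nat.succ_ne_zero, if_false]
    push_cast
    field_simp
    ring

end VMFB

/-! An accepted forward-backward step satisfies the usual three-point inequality of proximal
gradient methods, and projecting onto `Y` only brings points of `dom g` closer to the extrapolated
point. Hence the projection disappears and only `basic` in `IsInertialSequence` remains.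

Put t_k = (k + a)/a and v_k = x_k + t_k (x_{k+1} - x_k). Testing `basic` at a convex combination of
the iterate and a minimizer z gives, in `energy_succ_le`, E_{k+1}(z) ≤ (1 + η_{k+1}) E_k(z) for the
energy α_k t_k² (F(x_{k+1}) - F(z)) + ½‖v_k - z‖². Since ∑ η_k < ∞, E_k(z) converges for every
minimizer z. Thus the values tend to the minimum and (v_k) is bounded. So is (x_k), because x_{k+1}
is the average of x_k and v_k with weights k and a.

Uniqueness of the cluster point is an Opial-type argument. For two minimizers z, z', the difference
E_k(z) - E_k(z') has no value term and no square of v_k. What is left shows that ⟨v_k, D_{k+1}(z -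
z')⟩ converges. The vectors D_k(z - z') have a limit e, so ⟨v_k, e⟩ converges, and averaging passes
this on to ⟨x_k, e⟩ (`exists_tendsto_inner`). If z and z' are both cluster points, then ⟨z - z', e⟩
= 0, whereas D_k ⪰ ηI makes this at least η‖z - z'‖². Cluster points are minimizers by lower
semicontinuity. -/

namespace VMFB

open Filter Topology Set

/-! ### Quadratic forms and the three-point inequality -/

section QuadraticForm

variable {n : ℕ} {D : Matrix (Fin n) (Fin n) ℝ}

/-- The bilinear form `uᵀ D v`. -/
noncomputable def bilin (D : Matrix (Fin n) (Fin n) ℝ) (u v : EuclideanSpace ℝ (Fin n)) : ℝ :=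
  inner ℝ u (Matrix.toEuclideanCLM (n := Fin n) (𝕜 := ℝ) D v)

theorem bilin_comm (hD : D.IsHermitian) (u v : EuclideanSpace ℝ (Fin n)) :
    bilin D u v = bilin D v u := by
  have h := (Matrix.isSymmetric_toEuclideanLin_iff.mpr hD) u v
  exact h.symm.trans (real_inner_comm _ _)

theorem sqNorm_add (hD : D.IsHermitian) (u v : EuclideanSpace ℝ (Fin n)) :
    sqNorm D (u + v) = sqNorm D u + 2 * bilin D u v + sqNorm D v := by
  have h := bilin_comm hD u v
  unfold bilin at h
  simp only [sqNorm, bilin, map_add, inner_add_left, inner_add_right]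
  linarith

theorem sqNorm_smul (c : ℝ) (u : EuclideanSpace ℝ (Fin n)) :
    sqNorm D (c • u) = c ^ 2 * sqNorm D u := by
  simp only [sqNorm, map_smul, inner_smul_left, inner_smul_right]
  simp
  ring

theorem sqNorm_neg (u : EuclideanSpace ℝ (Fin n)) : sqNorm D (-u) = sqNorm D u := by
  simp [sqNorm]

theorem sqNorm_sub_comm (u v : EuclideanSpace ℝ (Fin n)) :
    sqNorm D (u - v) = sqNorm D (v - u) := by
  rw [← sqNorm_neg, neg_sub]

theorem sqNorm_sub (hD : D.IsHermitian) (u v : EuclideanSpace ℝ (Fin n)) :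
    sqNorm D (u - v) = sqNorm D u - 2 * bilin D u v + sqNorm D v := by
  rw [sub_eq_add_neg, sqNorm_add hD, sqNorm_neg]
  simp [bilin]
  ring

theorem bilin_smul_left (c : ℝ) (u v : EuclideanSpace ℝ (Fin n)) :
    bilin D (c • u) v = c * bilin D u v := by
  simp [bilin, inner_smul_left]

theorem continuous_sqNorm : Continuous (sqNorm D) := by
  unfold sqNorm
  fun_prop

theorem LoewnerLE.sqNorm_le {A B : Matrix (Fin n) (Fin n) ℝ} (h : LoewnerLE A B)
    (u : EuclideanSpace ℝ (Fin n)) : sqNorm A u ≤ sqNorm B u := by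
  have h1 := h.dotProduct_mulVec_nonneg (WithLp.ofLp u)
  simp only [star_trivial, Matrix.sub_mulVec, dotProduct_sub] at h1
  simp only [sqNorm, Matrix.inner_toEuclideanCLM]
  linarith

theorem sqNorm_smul_matrix (c : ℝ) (A : Matrix (Fin n) (Fin n) ℝ)
    (u : EuclideanSpace ℝ (Fin n)) : sqNorm (c • A) u = c * sqNorm A u := by
  simp only [sqNorm, map_smul, smul_apply, inner_smul_right]

theorem le_sqNorm {η : ℝ} (hD : D ∈ metricSet n η) (u : EuclideanSpace ℝ (Fin n)) :
    η * ‖u‖ ^ 2 ≤ sqNorm D u := by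
  have h := hD.2.sqNorm_le u
  rw [sqNorm_smul_matrix] at h
  simpa [sqNorm] using h

theorem sqNorm_nonneg (hD : D.PosDef) (u : EuclideanSpace ℝ (Fin n)) : 0 ≤ sqNorm D u := by
  have h1 := hD.posSemidef.dotProduct_mulVec_nonneg (WithLp.ofLp u)
  simpa [sqNorm, Matrix.inner_toEuclideanCLM] using h1

/-- The three-point inequality: a minimizer `p` of a convex function plus `c ‖· - x‖_D²` satisfies
the minimality with the extra term `c ‖· - p‖_D²`. -/
theorem minimizer_three_point (hD : D.IsHermitian) {S : Set (EuclideanSpace ℝ (Fin n))}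
    {h : EuclideanSpace ℝ (Fin n) → ℝ} (hconv : ConvexOn ℝ S h) {c : ℝ}
    {x p z : EuclideanSpace ℝ (Fin n)} (hp : p ∈ S)
    (hmin : ∀ w ∈ S, h p + c * sqNorm D (p - x) ≤ h w + c * sqNorm D (w - x)) (hz : z ∈ S) :
    h p + c * sqNorm D (p - x) + c * sqNorm D (z - p) ≤ h z + c * sqNorm D (z - x) := by
  -- Minimality is tested at the point (1 - t) p + t z of the segment; the resulting inequality is
  -- divided by t, and then t → 0 removes the second-order term.
  have key : ∀ t : ℝ, 0 < t → t ≤ 1 →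
      0 ≤ (h z - h p + 2 * c * bilin D (z - p) (p - x)) + t * (c * sqNorm D (z - p)) := by
    intro t ht0 ht1
    have hw : (1 - t) • p + t • z ∈ S :=
      hconv.1 hp hz (by linarith) ht0.le (by ring)
    have h1 := hmin _ hw
    have h2 := hconv.2 hp hz (by linarith : (0 : ℝ) ≤ 1 - t) ht0.le (by ring)
    have e : (1 - t) • p + t • z - x = t • (z - p) + (p - x) := by module
    rw [e, sqNorm_add hD, sqNorm_smul, bilin_smul_left] at h1
    simp only [smul_eq_mul] at h2
    have h3 : 0 ≤ t * ((h z - h p + 2 * c * bilin D (z - p) (p - x))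
        + t * (c * sqNorm D (z - p))) := by nlinarith
    exact nonneg_of_mul_nonneg_right h3 ht0
  have lim : Tendsto (fun t : ℝ => (h z - h p + 2 * c * bilin D (z - p) (p - x))
      + t * (c * sqNorm D (z - p))) (𝓝[>] 0) (𝓝 ((h z - h p + 2 * c * bilin D (z - p) (p - x))
      + 0 * (c * sqNorm D (z - p)))) := by
    apply Tendsto.mono_left _ nhdsWithin_le_nhds
    exact Continuous.tendsto (by fun_prop) 0
  have h0 := ge_of_tendsto lim (by
    filter_upwards [Ioc_mem_nhdsGT (zero_lt_one' ℝ)] with t ht using key t ht.1 ht.2)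
  have e : z - x = (z - p) + (p - x) := by abel
  rw [e, sqNorm_add hD]
  nlinarith

end QuadraticForm

/-! ### Two lemmas on real sequences -/

section Sequences

/-- A nonnegative sequence with `e (k + 1) ≤ (1 + ε k) * e k`, `∑ ε k < ∞`, converges. -/
theorem exists_tendsto_of_le_one_add_mul {e ε : ℕ → ℝ} (he : ∀ k, 0 ≤ e k) (hε : ∀ k, 0 ≤ ε k)
    (hsum : Summable ε) (h : ∀ k, e (k + 1) ≤ (1 + ε k) * e k) :
    ∃ l, Tendsto e atTop (𝓝 l) := by
  -- Dividing by these partial products makes `e` antitone; the products themselves increase and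
  -- stay below exp(∑ ε), so both factors of e = P · (e / P) converge.
  set P : ℕ → ℝ := fun k => ∏ j ∈ Finset.range k, (1 + ε j) with hP
  have hPpos : ∀ k, 0 < P k := fun k => Finset.prod_pos fun j _ => by linarith [hε j]
  have hPs : ∀ k, P (k + 1) = P k * (1 + ε k) := fun k => Finset.prod_range_succ _ _
  have hPmono : Monotone P := monotone_nat_of_le_succ fun k => by
    rw [hPs]
    nlinarith [hPpos k, hε k]
  have hPbdd : BddAbove (range P) := by
    refine ⟨Real.exp (∑' j, ε j), ?_⟩
    rintro _ ⟨k, rfl⟩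
    calc P k ≤ ∏ j ∈ Finset.range k, Real.exp (ε j) :=
          Finset.prod_le_prod (fun j _ => by linarith [hε j]) fun j _ => by
            linarith [Real.add_one_le_exp (ε j)]
      _ = Real.exp (∑ j ∈ Finset.range k, ε j) := (Real.exp_sum _ _).symm
      _ ≤ _ := Real.exp_le_exp.2 (hsum.sum_le_tsum _ fun j _ => hε j)
  have h1 := tendsto_atTop_ciSup hPmono hPbdd
  have hanti : Antitone fun k => e k / P k := antitone_nat_of_succ_le fun k => by
    rw [hPs, div_le_div_iff₀ (mul_pos (hPpos k) (by linarith [hε k])) (hPpos k)]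
    nlinarith [hPpos k, h k]
  have hbdd : BddBelow (range fun k => e k / P k) := by
    refine ⟨0, ?_⟩
    rintro _ ⟨k, rfl⟩
    exact div_nonneg (he k) (hPpos k).le
  have h2 := tendsto_atTop_ciInf hanti hbdd
  refine ⟨_, (h1.mul h2).congr fun k => ?_⟩
  field_simp [(hPpos k).ne']

/-- Averages with weights `a / (k + a)`, `a ≥ 1`, inherit the limit of the averaged sequence. -/
theorem tendsto_of_weighted_average {a l : ℝ} (ha : 1 ≤ a) {s r : ℕ → ℝ}
    (hr : Tendsto r atTop (𝓝 l))
    (h : ∀ k : ℕ, ((k : ℝ) + a) * s (k + 1) = k * s k + a * r k) :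
    Tendsto s atTop (𝓝 l) := by
  rw [Metric.tendsto_atTop]
  intro ε hε
  obtain ⟨N, hN⟩ := Metric.tendsto_atTop.1 hr (ε / 2) (half_pos hε)
  -- The excess of the error over ε/2. Once `r` is within ε/2 of its limit, (k + a) d (k + 1) ≤ k d
  -- k, and a ≥ 1 makes k d k nonincreasing, so d = O(1/k).
  set d : ℕ → ℝ := fun k => max (|s k - l| - ε / 2) 0 with hd
  have hd0 : ∀ k, 0 ≤ d k := fun k => le_max_right _ _
  have hstep : ∀ k ≥ N, ((k : ℝ) + 1) * d (k + 1) ≤ k * d k := by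
    intro k hk
    have hk0 : (0 : ℝ) ≤ k := k.cast_nonneg
    have hrk := hN k hk
    rw [Real.dist_eq] at hrk
    have h1 : ((k : ℝ) + a) * |s (k + 1) - l| ≤ k * |s k - l| + a * |r k - l| := by
      have e : ((k : ℝ) + a) * (s (k + 1) - l) = k * (s k - l) + a * (r k - l) := by
        linarith [h k]
      calc ((k : ℝ) + a) * |s (k + 1) - l| = |((k : ℝ) + a) * (s (k + 1) - l)| := by
            rw [abs_mul, abs_of_nonneg (by linarith : 0 ≤ (k : ℝ) + a)]
        _ ≤ |(k : ℝ) * (s k - l)| + |a * (r k - l)| := by rw [e]; exact abs_add_le _ _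
        _ = _ := by rw [abs_mul, abs_mul, abs_of_nonneg hk0, abs_of_nonneg (by linarith : 0 ≤ a)]
    have h2 : ((k : ℝ) + a) * d (k + 1) ≤ k * d k := by
      have h3 : |s k - l| - ε / 2 ≤ d k := le_max_left _ _
      rcases max_cases (|s (k + 1) - l| - ε / 2) 0 with ⟨hc, _⟩ | ⟨hc, _⟩
      · simp only [hd] at h3 ⊢
        rw [hc]
        nlinarith
      · have : d (k + 1) = 0 := hc
        rw [this, mul_zero]
        exact mul_nonneg hk0 (hd0 k)
    nlinarith [hd0 (k + 1)]
  have hbound : ∀ k ≥ N, (k : ℝ) * d k ≤ N * d N := by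
    intro k hk
    induction k, hk using Nat.le_induction with
    | base => exact le_rfl
    | succ k hk ih =>
      push_cast
      exact (hstep k hk).trans ih
  obtain ⟨M, hM⟩ := exists_nat_gt (N * d N / (ε / 2))
  refine ⟨max N (M + 1), fun k hk => ?_⟩
  have hkN : N ≤ k := le_trans (le_max_left _ _) hk
  have hkM : (M : ℝ) + 1 ≤ k := by exact_mod_cast le_trans (le_max_right _ _) hk
  have h1 := hbound k hkN
  rw [div_lt_iff₀ (half_pos hε)] at hM
  have h3 : |s k - l| - ε / 2 ≤ d k := le_max_left _ _
  rw [Real.dist_eq]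
  by_contra hcon
  push Not at hcon
  have h4 : ε / 2 ≤ d k := by linarith
  have : (k : ℝ) * (ε / 2) ≤ k * d k := mul_le_mul_of_nonneg_left h4 k.cast_nonneg
  nlinarith

end Sequences

/-! ### Limits of the scaling matrices -/

section MatrixLimits

variable {n : ℕ} {D : ℕ → Matrix (Fin n) (Fin n) ℝ} {η : ℝ} {ηs : ℕ → ℝ}

theorem sqNorm_succ_le (hDη : ∀ k, LoewnerLE (D (k + 1)) ((1 + ηs k) • D k)) (k : ℕ)
    (u : EuclideanSpace ℝ (Fin n)) : sqNorm (D (k + 1)) u ≤ (1 + ηs k) * sqNorm (D k) u := by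
  rw [← sqNorm_smul_matrix]
  exact (hDη k).sqNorm_le u

/-- Each quadratic form value grows by a factor of at most 1 + η_k per step and so converges;
polarization does the rest. -/
theorem exists_tendsto_bilin (hD : ∀ k, (D k).PosDef) (hηs : ∀ k, 0 ≤ ηs k) (hsum : Summable ηs)
    (hDη : ∀ k, LoewnerLE (D (k + 1)) ((1 + ηs k) • D k)) (u v : EuclideanSpace ℝ (Fin n)) :
    ∃ l, Tendsto (fun k => bilin (D k) u v) atTop (𝓝 l) := by
  have h (w : EuclideanSpace ℝ (Fin n)) : ∃ l, Tendsto (fun k => sqNorm (D k) w) atTop (𝓝 l) :=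
    exists_tendsto_of_le_one_add_mul (fun k => sqNorm_nonneg (hD k) w) hηs hsum
      fun k => sqNorm_succ_le hDη k w
  obtain ⟨l₁, h₁⟩ := h (u + v)
  obtain ⟨l₂, h₂⟩ := h u
  obtain ⟨l₃, h₃⟩ := h v
  refine ⟨_, (((h₁.sub h₂).sub h₃).div_const 2).congr fun k => ?_⟩
  rw [sqNorm_add (hD k).1]
  ring

theorem exists_tendsto_toEuclideanCLM (hD : ∀ k, (D k).PosDef) (hηs : ∀ k, 0 ≤ ηs k)
    (hsum : Summable ηs) (hDη : ∀ k, LoewnerLE (D (k + 1)) ((1 + ηs k) • D k))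
    (v : EuclideanSpace ℝ (Fin n)) :
    ∃ e, Tendsto (fun k => Matrix.toEuclideanCLM (n := Fin n) (𝕜 := ℝ) (D k) v)
      atTop (𝓝 e) := by
  choose l hl using fun i : Fin n =>
    exists_tendsto_bilin hD hηs hsum hDη (EuclideanSpace.single i 1) v
  refine ⟨WithLp.toLp 2 l, ?_⟩
  have h : Tendsto (fun k => WithLp.ofLp (Matrix.toEuclideanCLM (n := Fin n) (𝕜 := ℝ) (D k) v))
      atTop (𝓝 l) := by
    rw [tendsto_pi_nhds]
    intro i
    refine (hl i).congr fun k => ?_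
    simp only [bilin, EuclideanSpace.inner_single_left]
    simp
  exact ((PiLp.continuous_toLp 2 (fun _ : Fin n => ℝ)).tendsto l).comp h

end MatrixLimits

/-! ### Convexity and existence of minimizers -/

section ConvexAnalysis

theorem coe_toReal_of_mem_dom {E : Type*} {f : E → EReal} (hf : ∀ x, f x ≠ ⊥) {x : E}
    (hx : x ∈ dom f) : ((f x).toReal : EReal) = f x :=
  EReal.coe_toReal (ne_of_lt hx) (hf x)

theorem IsConvex.convexOn_toReal {E : Type*} [AddCommGroup E] [Module ℝ E] {f : E → EReal}
    (hf : ∀ x, f x ≠ ⊥) (hconv : IsConvex f) :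
    ConvexOn ℝ (dom f) fun x => (f x).toReal := by
  have key : ∀ x ∈ dom f, ∀ y ∈ dom f, ∀ s t : ℝ, 0 ≤ s → 0 ≤ t → s + t = 1 →
      f (s • x + t • y) ≤ ((s * (f x).toReal + t * (f y).toReal : ℝ) : EReal) := by
    intro x hx y hy s t hs ht hst
    exact hconv (x := (x, (f x).toReal)) (coe_toReal_of_mem_dom hf hx).ge
      (y := (y, (f y).toReal)) (coe_toReal_of_mem_dom hf hy).ge hs ht hst
  have hdom : ∀ x ∈ dom f, ∀ y ∈ dom f, ∀ s t : ℝ, 0 ≤ s → 0 ≤ t → s + t = 1 →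
      s • x + t • y ∈ dom f := fun x hx y hy s t hs ht hst =>
    (key x hx y hy s t hs ht hst).trans_lt (EReal.coe_lt_top _)
  refine ⟨fun x hx y hy s t hs ht hst => hdom x hx y hy s t hs ht hst,
    fun x hx y hy s t hs ht hst => ?_⟩
  have h := key x hx y hy s t hs ht hst
  rw [← coe_toReal_of_mem_dom hf (hdom x hx y hy s t hs ht hst), EReal.coe_le_coe_iff] at h
  simpa using h

/-- A convex function lies above its linearization by a gradient relative to its domain. -/
theorem ConvexOn.add_inner_gradient_le {E : Type*} [NormedAddCommGroup E]
    [InnerProductSpace ℝ E] [CompleteSpace E] {Y : Set E} {h : E → ℝ} (hconv : ConvexOn ℝ Y h)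
    {v x z : E} (hx : x ∈ Y) (hz : z ∈ Y) (hv : HasGradientWithinAt h v Y x) :
    h x + inner ℝ v (z - x) ≤ h z := by
  -- Restricting to the segment from x to z reduces the claim to one variable, where the slope over
  -- [0, 1] dominates the one-sided derivative at 0.
  have hmaps : MapsTo (AffineMap.lineMap x z : ℝ → E) (Icc 0 1) Y := fun t ht =>
    hconv.1.lineMap_mem hx hz ht
  have hc : ConvexOn ℝ (Icc (0 : ℝ) 1) (h ∘ (AffineMap.lineMap x z : ℝ →ᵃ[ℝ] E)) :=
    (hconv.comp_affineMap _).subset hmaps (convex_Icc 0 1)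
  have hd : HasDerivWithinAt (h ∘ (AffineMap.lineMap x z : ℝ → E)) (inner ℝ v (z - x))
      (Icc 0 1) 0 := by
    have h1 : HasDerivWithinAt (AffineMap.lineMap x z : ℝ → E) (z - x) (Icc 0 1) 0 :=
      AffineMap.hasDerivWithinAt_lineMap
    have h2 := hv.hasFDerivWithinAt
    rw [← AffineMap.lineMap_apply_zero (k := ℝ) x z] at h2
    have h3 := h2.comp_hasDerivWithinAt (0 : ℝ) h1 hmaps
    simpa using h3
  have h4 := hc.le_slope_of_hasDerivWithinAt (by simp) (by simp) one_pos hd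
  simp [slope_def_field] at h4
  linarith

/-- A lower semicontinuous function with a bounded sublevel set on a closed set attains its
minimum there. -/
theorem exists_isMinOn_of_isBounded_sublevel {E : Type*} [PseudoMetricSpace E] [ProperSpace E]
    {φ : E → EReal} (hφ : LowerSemicontinuous φ) {S : Set E} (hS : IsClosed S) {x₀ : E}
    (hx₀ : x₀ ∈ S) (hb : Bornology.IsBounded {x ∈ S | φ x ≤ φ x₀}) :
    ∃ y ∈ S, ∀ z ∈ S, φ y ≤ φ z := by
  have hcl : IsClosed {x ∈ S | φ x ≤ φ x₀} := hS.inter (hφ.isClosed_preimage (φ x₀))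
  have hne : {x ∈ S | φ x ≤ φ x₀}.Nonempty := ⟨x₀, hx₀, le_rfl⟩
  obtain ⟨y, hy, hmin⟩ := LowerSemicontinuousOn.exists_isMinOn hne
    (Metric.isCompact_of_isClosed_isBounded hcl hb) (hφ.lowerSemicontinuousOn _)
  refine ⟨y, hy.1, fun z hz => ?_⟩
  by_cases h : φ z ≤ φ x₀
  · exact hmin ⟨hz, h⟩
  · exact (hmin ⟨hx₀, le_rfl⟩).trans (not_le.1 h).le

theorem argmin_spec {E : Type*} [Nonempty E] {φ : E → EReal} {S : Set E}
    (h : ∃ y ∈ S, ∀ z ∈ S, φ y ≤ φ z) : argmin φ S ∈ S ∧ ∀ z ∈ S, φ (argmin φ S) ≤ φ z :=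
  Classical.epsilon_spec h

end ConvexAnalysis

/-! ### Projection in a scaled metric -/

section Projection

variable {n : ℕ} {Y : Set (EuclideanSpace ℝ (Fin n))} {D : Matrix (Fin n) (Fin n) ℝ} {η : ℝ}

theorem proj_spec (hY : IsClosed Y) (hne : Y.Nonempty) (hη : 0 < η) (hD : D ∈ metricSet n η)
    (x : EuclideanSpace ℝ (Fin n)) :
    proj Y D x ∈ Y ∧ ∀ z ∈ Y, sqNorm D (proj Y D x - x) ≤ sqNorm D (z - x) := by
  obtain ⟨x₀, hx₀⟩ := hne
  have hcont : Continuous fun y => ((sqNorm D (y - x) : ℝ) : EReal) :=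
    continuous_coe_real_ereal.comp (continuous_sqNorm.comp (continuous_sub_right x))
  have hb : Bornology.IsBounded
      {y ∈ Y | ((sqNorm D (y - x) : ℝ) : EReal) ≤ ((sqNorm D (x₀ - x) : ℝ) : EReal)} := by
    refine (Metric.isBounded_closedBall (x := x) (r := √(sqNorm D (x₀ - x) / η))).subset ?_
    rintro y ⟨-, hy⟩
    rw [EReal.coe_le_coe_iff] at hy
    rw [mem_closedBall_iff_norm]
    apply Real.le_sqrt_of_sq_le
    rw [le_div_iff₀ hη]
    linarith [le_sqNorm hD (y - x)]
  have h := argmin_spec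
    (exists_isMinOn_of_isBounded_sublevel hcont.lowerSemicontinuous hY hx₀ hb)
  exact ⟨h.1, fun z hz => EReal.coe_le_coe_iff.1 (h.2 z hz)⟩

/-- The three-point inequality for the zero function on `Y`, with one nonnegative term dropped. It
allows the extrapolated point to replace its projection in the estimates. -/
theorem sqNorm_sub_proj_le (hY : IsClosed Y) (hconv : Convex ℝ Y) (hη : 0 < η)
    (hD : D ∈ metricSet n η) (x : EuclideanSpace ℝ (Fin n)) {z : EuclideanSpace ℝ (Fin n)}
    (hz : z ∈ Y) : sqNorm D (z - proj Y D x) ≤ sqNorm D (z - x) := by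
  obtain ⟨h1, h2⟩ := proj_spec hY ⟨z, hz⟩ hη hD x
  have h3 := minimizer_three_point hD.1.1 (convexOn_const (0 : ℝ) hconv) (c := 1) h1
    (fun w hw => by simpa using h2 w hw) hz
  have h4 := sqNorm_nonneg hD.1 (proj Y D x - x)
  linarith

end Projection

/-! ### The forward-backward step and backtracking -/

section Step

variable {n : ℕ} {f g : EuclideanSpace ℝ (Fin n) → EReal}
  {gradf : EuclideanSpace ℝ (Fin n) → EuclideanSpace ℝ (Fin n)}
  {Y : Set (EuclideanSpace ℝ (Fin n))} {L : NNReal}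

/-- The assumptions on the composite problem `min f + g`. -/
structure CompositeProblem (f g : EuclideanSpace ℝ (Fin n) → EReal)
    (gradf : EuclideanSpace ℝ (Fin n) → EuclideanSpace ℝ (Fin n))
    (Y : Set (EuclideanSpace ℝ (Fin n))) (L : NNReal) : Prop where
  f_proper : IsProper f
  f_convex : IsConvex f
  f_lsc : LowerSemicontinuous f
  g_proper : IsProper g
  g_convex : IsConvex g
  g_lsc : LowerSemicontinuous g
  isClosed : IsClosed Y
  convex : Convex ℝ Y
  subset_dom : Y ⊆ dom f
  dom_subset : dom g ⊆ Y
  gradient : ∀ x ∈ Y, HasGradientWithinAt (fun u => (f u).toReal) (gradf x) Y x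
  lipschitz : LipschitzOnWith L gradf Y
  g_bounded_below : ∃ m : ℝ, ∀ x ∈ dom g, (m : EReal) ≤ g x

/-- The real value of the objective `f + g`, meaningful on the domain of `g`. -/
noncomputable def objective (f g : EuclideanSpace ℝ (Fin n) → EReal)
    (x : EuclideanSpace ℝ (Fin n)) : ℝ := (f x).toReal + (g x).toReal

namespace CompositeProblem

variable {D : Matrix (Fin n) (Fin n) ℝ} {η α δ : ℝ} {x y z : EuclideanSpace ℝ (Fin n)}

theorem coe_f (P : CompositeProblem f g gradf Y L) (hx : x ∈ Y) :
    ((f x).toReal : EReal) = f x := coe_toReal_of_mem_dom P.f_proper.1 (P.subset_dom hx)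

theorem coe_g (P : CompositeProblem f g gradf Y L) (hx : x ∈ dom g) :
    ((g x).toReal : EReal) = g x := coe_toReal_of_mem_dom P.g_proper.1 hx

theorem coe_objective (P : CompositeProblem f g gradf Y L) (hx : x ∈ dom g) :
    (objective f g x : EReal) = f x + g x := by
  rw [objective, EReal.coe_add, P.coe_f (P.dom_subset hx), P.coe_g hx]

theorem convexOn_f (P : CompositeProblem f g gradf Y L) :
    ConvexOn ℝ Y fun x => (f x).toReal :=
  (P.f_convex.convexOn_toReal P.f_proper.1).subset P.subset_dom P.convex

theorem convexOn_g (P : CompositeProblem f g gradf Y L) :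
    ConvexOn ℝ (dom g) fun x => (g x).toReal := P.g_convex.convexOn_toReal P.g_proper.1

theorem convexOn_objective (P : CompositeProblem f g gradf Y L) :
    ConvexOn ℝ (dom g) (objective f g) :=
  (P.convexOn_f.subset P.dom_subset P.convexOn_g.1).add P.convexOn_g

/-- The gradient inequality at z and Cauchy–Schwarz suffice. The constant is L instead of the sharp
L/2, which only affects the lower bound on the step lengths. -/
theorem f_le_linearization (P : CompositeProblem f g gradf Y L) (hx : x ∈ Y) (hz : z ∈ Y) :
    (f z).toReal ≤ (f x).toReal + inner ℝ (gradf x) (z - x) + L * ‖z - x‖ ^ 2 := by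
  have h1 := ConvexOn.add_inner_gradient_le P.convexOn_f hz hx (P.gradient z hz)
  have h2 : inner ℝ (gradf z - gradf x) (z - x) ≤ L * ‖z - x‖ ^ 2 := by
    have h3 := P.lipschitz.dist_le_mul z hz x hx
    rw [dist_eq_norm, dist_eq_norm] at h3
    calc inner ℝ (gradf z - gradf x) (z - x) ≤ ‖gradf z - gradf x‖ * ‖z - x‖ :=
          real_inner_le_norm _ _
      _ ≤ L * ‖z - x‖ * ‖z - x‖ := by gcongr
      _ = _ := by ring
  rw [← neg_sub z x, inner_neg_right] at h1
  rw [inner_sub_left] at h2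
  linarith

theorem model_eq (P : CompositeProblem f g gradf Y L) (hy : y ∈ Y)
    (z : EuclideanSpace ℝ (Fin n)) :
    model f g gradf α D z y = g z + (((f y).toReal + inner ℝ (gradf y) (z - y) +
      1 / (2 * α) * sqNorm D (z - y) : ℝ) : EReal) := by
  rw [model, lin, ← P.coe_f hy, EReal.coe_add, EReal.coe_add, sqNorm_sub_comm y z,
    EReal.toReal_coe]
  abel

theorem fbStep_isMin (P : CompositeProblem f g gradf Y L) (hη : 0 < η) (hD : D ∈ metricSet n η)
    (hα : 0 < α) (hy : y ∈ Y) :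
    ∀ z, model f g gradf α D (fbStep f g gradf α D y) y ≤ model f g gradf α D z y := by
  obtain ⟨x₀, hx₀⟩ := P.g_proper.2
  obtain ⟨m, hm⟩ := P.g_bounded_below
  have hm' : ∀ z, (m : EReal) ≤ g z := fun z => by
    by_cases hz : z ∈ dom g
    · exact hm z hz
    · exact le_top.trans (not_lt.1 hz)
  have hlsc : LowerSemicontinuous fun z => model f g gradf α D z y := by
    simp_rw [P.model_eq hy]
    have hcont : Continuous fun z => (((f y).toReal + inner ℝ (gradf y) (z - y) +
        1 / (2 * α) * sqNorm D (z - y) : ℝ) : EReal) := by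
      have := continuous_sqNorm (D := D)
      exact continuous_coe_real_ereal.comp (by fun_prop)
    exact P.g_lsc.add' hcont.lowerSemicontinuous fun z =>
      EReal.continuousAt_add (Or.inr (EReal.coe_ne_bot _)) (Or.inr (EReal.coe_ne_top _))
  have hb : Bornology.IsBounded
      {z ∈ (univ : Set _) | model f g gradf α D z y ≤ model f g gradf α D x₀ y} := by
    have hx₀R : ∃ R : ℝ, model f g gradf α D x₀ y = (R : EReal) := by
      rw [P.model_eq hy, ← P.coe_g hx₀, ← EReal.coe_add]
      exact ⟨_, rfl⟩
    obtain ⟨R, hR⟩ := hx₀R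
    set c : ℝ := 1 / (2 * α) * η with hc
    have hcpos : 0 < c := by positivity
    set K : ℝ := R - m - (f y).toReal with hK
    set v : ℝ := ‖gradf y‖ with hv
    -- The sublevel condition reads c r² - v r ≤ K for r = ‖z - y‖. Beyond this radius r ≥ 1 and c r
    -- - v > |K|, which is contradictory.
    refine (Metric.isBounded_closedBall (x := y) (r := (v + |K|) / c + 1)).subset ?_
    rintro z ⟨-, hz⟩
    rw [hR, P.model_eq hy] at hz
    have h1 := (add_le_add_left (hm' z) _).trans hz
    rw [← EReal.coe_add, EReal.coe_le_coe_iff] at h1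
    have h2 : -(v * ‖z - y‖) ≤ inner ℝ (gradf y) (z - y) :=
      (abs_le.1 (abs_real_inner_le_norm _ _)).1
    have h3 : c * ‖z - y‖ ^ 2 ≤ 1 / (2 * α) * sqNorm D (z - y) := by
      rw [hc, mul_assoc]
      exact mul_le_mul_of_nonneg_left (le_sqNorm hD _) (by positivity)
    rw [mem_closedBall_iff_norm]
    by_contra hcon
    push Not at hcon
    set r := ‖z - y‖
    have hv0 : 0 ≤ v := norm_nonneg _
    have hr1 : 1 ≤ r := le_trans (by
      have : 0 ≤ (v + |K|) / c := by positivity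
      linarith) hcon.le
    have hr2 : v + |K| < c * r := by
      have : (v + |K|) / c < r := by linarith
      rwa [div_lt_iff₀ hcpos, mul_comm] at this
    have h4 : c * r ^ 2 - v * r ≤ |K| := by
      have := le_abs_self K
      rw [hK] at this
      linarith
    nlinarith [abs_nonneg K]
  have h := argmin_spec (exists_isMinOn_of_isBounded_sublevel hlsc isClosed_univ
    (mem_univ x₀) hb)
  exact fun z => h.2 z (mem_univ z)

theorem fbStep_mem (P : CompositeProblem f g gradf Y L) (hη : 0 < η) (hD : D ∈ metricSet n η)
    (hα : 0 < α) (hy : y ∈ Y) : fbStep f g gradf α D y ∈ dom g := by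
  obtain ⟨x₀, hx₀⟩ := P.g_proper.2
  have h := P.fbStep_isMin hη hD hα hy x₀
  rw [P.model_eq hy, P.model_eq hy, ← P.coe_g hx₀, ← EReal.coe_add] at h
  by_contra hcon
  have htop : g (fbStep f g gradf α D y) = ⊤ := top_le_iff.1 (not_lt.1 hcon)
  rw [htop, EReal.top_add_coe] at h
  exact EReal.coe_ne_top _ (top_le_iff.1 h)

theorem fbStep_three_point (P : CompositeProblem f g gradf Y L) (hη : 0 < η)
    (hD : D ∈ metricSet n η) (hα : 0 < α) (hy : y ∈ Y) (hz : z ∈ dom g) :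
    (g (fbStep f g gradf α D y)).toReal + inner ℝ (gradf y) (fbStep f g gradf α D y - y)
      + 1 / (2 * α) * sqNorm D (fbStep f g gradf α D y - y)
      + 1 / (2 * α) * sqNorm D (z - fbStep f g gradf α D y)
    ≤ (g z).toReal + inner ℝ (gradf y) (z - y) + 1 / (2 * α) * sqNorm D (z - y) := by
  have hp := P.fbStep_mem hη hD hα hy
  have hlin : ConvexOn ℝ (dom g) fun w => inner ℝ (gradf y) (w - y) := by
    refine ⟨P.convexOn_g.1, fun u _ w _ s t _ _ hst => le_of_eq ?_⟩
    have e : s • u + t • w - y = s • (u - y) + t • (w - y) := by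
      have : y = (s + t) • y := by rw [hst, one_smul]
      nth_rewrite 1 [this]
      module
    simp only [e, inner_add_right, inner_smul_right, smul_eq_mul]
  refine minimizer_three_point (D := D) hD.1.1 (P.convexOn_g.add hlin) hp (fun w hw => ?_) hz
  have h := P.fbStep_isMin hη hD hα hy w
  rw [P.model_eq hy, P.model_eq hy, ← P.coe_g hw, ← P.coe_g hp, ← EReal.coe_add,
    ← EReal.coe_add, EReal.coe_le_coe_iff] at h
  simp only [Pi.add_apply]
  linarith

theorem accepts_iff (P : CompositeProblem f g gradf Y L) (hη : 0 < η) (hD : D ∈ metricSet n η)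
    (hα : 0 < α) (hy : y ∈ Y) :
    Accepts f g gradf D y α ↔ (f (fbStep f g gradf α D y)).toReal ≤ (f y).toReal
      + inner ℝ (gradf y) (fbStep f g gradf α D y - y)
      + 1 / (2 * α) * sqNorm D (fbStep f g gradf α D y - y) := by
  have hp := P.dom_subset (P.fbStep_mem hη hD hα hy)
  rw [Accepts, lin, ← P.coe_f hp, ← P.coe_f hy, ← EReal.coe_add, ← EReal.coe_add,
    EReal.coe_le_coe_iff, sqNorm_sub_comm, EReal.toReal_coe, EReal.toReal_coe]

/-- The test holds as soon as L ≤ η/(2α), by `f_le_linearization`; L + 1 in the threshold avoids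
division by zero. -/
theorem accepts_of_le (P : CompositeProblem f g gradf Y L) (hη : 0 < η)
    (hD : D ∈ metricSet n η) (hα : 0 < α) (hαL : α ≤ η / (2 * (L + 1))) (hy : y ∈ Y) :
    Accepts f g gradf D y α := by
  rw [P.accepts_iff hη hD hα hy]
  have h := P.f_le_linearization hy (P.dom_subset (P.fbStep_mem hη hD hα hy))
  set p := fbStep f g gradf α D y
  have h1 : (L : ℝ) * ‖p - y‖ ^ 2 ≤ 1 / (2 * α) * sqNorm D (p - y) := by
    have hL : (0 : ℝ) ≤ L := L.2
    rw [le_div_iff₀ (by positivity)] at hαL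
    have h2 : (L : ℝ) ≤ 1 / (2 * α) * η := by
      rw [div_mul_eq_mul_div, le_div_iff₀ (by positivity)]
      nlinarith
    calc (L : ℝ) * ‖p - y‖ ^ 2 ≤ 1 / (2 * α) * η * ‖p - y‖ ^ 2 := by gcongr
      _ ≤ _ := by
        rw [mul_assoc]
        exact mul_le_mul_of_nonneg_left (le_sqNorm hD _) (by positivity)
  linarith

/-- The basic inequality for an accepted forward-backward step. -/
theorem objective_fbStep_le (P : CompositeProblem f g gradf Y L) (hη : 0 < η)
    (hD : D ∈ metricSet n η) (hα : 0 < α) (hy : y ∈ Y) (hz : z ∈ dom g)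
    (hacc : Accepts f g gradf D y α) :
    objective f g (fbStep f g gradf α D y)
      + 1 / (2 * α) * sqNorm D (z - fbStep f g gradf α D y)
    ≤ objective f g z + 1 / (2 * α) * sqNorm D (z - y) := by
  rw [P.accepts_iff hη hD hα hy] at hacc
  have h1 := P.fbStep_three_point hη hD hα hy hz
  have h2 := ConvexOn.add_inner_gradient_le P.convexOn_f hy (P.dom_subset hz) (P.gradient y hy)
  simp only [objective]
  linarith

/-- Either no reduction is made, or the last rejected trial exceeded the threshold of
`accepts_of_le` and the result is δ times that trial. -/
theorem backtrack_spec (P : CompositeProblem f g gradf Y L) (hη : 0 < η)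
    (hD : D ∈ metricSet n η) (hα : 0 < α) (hy : y ∈ Y) (hδ0 : 0 < δ) (hδ1 : δ < 1) :
    Accepts f g gradf D y (backtrack f g gradf δ D y α) ∧
      backtrack f g gradf δ D y α ≤ α ∧
      min α (δ * (η / (2 * (L + 1)))) ≤ backtrack f g gradf δ D y α := by
  have hL : (0 : ℝ) ≤ L := L.2
  have hcpos : 0 < η / (2 * ((L : ℝ) + 1)) := by positivity
  have hne : {i : ℕ | Accepts f g gradf D y (δ ^ i * α)}.Nonempty := by
    obtain ⟨i, hi⟩ := exists_pow_lt_of_lt_one (div_pos hcpos hα) hδ1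
    rw [lt_div_iff₀ hα] at hi
    exact ⟨i, P.accepts_of_le hη hD (by positivity) hi.le hy⟩
  refine ⟨Nat.sInf_mem hne, mul_le_of_le_one_left hα.le (pow_le_one₀ hδ0.le hδ1.le), ?_⟩
  rw [backtrack]
  rcases hi : sInf {i : ℕ | Accepts f g gradf D y (δ ^ i * α)} with _ | j
  · simp
  · have hj : j ∉ {i : ℕ | Accepts f g gradf D y (δ ^ i * α)} :=
      Nat.notMem_of_lt_sInf (by omega)
    have hlt : η / (2 * ((L : ℝ) + 1)) < δ ^ j * α := by
      by_contra hcon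
      exact hj (P.accepts_of_le hη hD (by positivity) (not_lt.1 hcon) hy)
    refine (min_le_right _ _).trans ?_
    rw [pow_succ']
    nlinarith

end CompositeProblem

end Step

/-! ### Lyapunov analysis of inertial sequences -/

section InertialSequence

variable {n : ℕ} {C : Set (EuclideanSpace ℝ (Fin n))} {F : EuclideanSpace ℝ (Fin n) → ℝ}
  {D : ℕ → Matrix (Fin n) (Fin n) ℝ} {η a : ℝ} {ηs α : ℕ → ℝ}
  {x : ℕ → EuclideanSpace ℝ (Fin n)} {z z' : EuclideanSpace ℝ (Fin n)}

/-- Sequences that satisfy the basic inequality of the inertial forward-backward method in a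
variable metric. -/
structure IsInertialSequence (C : Set (EuclideanSpace ℝ (Fin n)))
    (F : EuclideanSpace ℝ (Fin n) → ℝ) (D : ℕ → Matrix (Fin n) (Fin n) ℝ) (η a : ℝ)
    (ηs α : ℕ → ℝ) (x : ℕ → EuclideanSpace ℝ (Fin n)) : Prop where
  convexOn : ConvexOn ℝ C F
  eta_pos : 0 < η
  mem_metricSet : ∀ k, D k ∈ metricSet n η
  etas_nonneg : ∀ k, 0 ≤ ηs k
  summable : Summable ηs
  loewnerLE : ∀ k, LoewnerLE (D (k + 1)) ((1 + ηs k) • D k)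
  two_le : 2 ≤ a
  antitone : Antitone α
  steps_bounded_below : ∃ c > 0, ∀ k, c ≤ α k
  mem : ∀ k, x (k + 1) ∈ C
  basic : ∀ k, ∀ z ∈ C, F (x (k + 2)) + 1 / (2 * α (k + 1)) * sqNorm (D (k + 1)) (z - x (k + 2))
    ≤ F z + 1 / (2 * α (k + 1)) *
      sqNorm (D (k + 1)) (z - (x (k + 1) + beta a (k + 1) • (x (k + 1) - x k)))

/-- The auxiliary points `x k + t k (x (k + 1) - x k)` with `t k = (k + a) / a`. -/
noncomputable def extrapolated (a : ℝ) (x : ℕ → EuclideanSpace ℝ (Fin n)) (k : ℕ) :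
    EuclideanSpace ℝ (Fin n) := x k + (((k : ℝ) + a) / a) • (x (k + 1) - x k)

/-- The Lyapunov function of the method. -/
noncomputable def energy (F : EuclideanSpace ℝ (Fin n) → ℝ) (D : ℕ → Matrix (Fin n) (Fin n) ℝ)
    (a : ℝ) (α : ℕ → ℝ) (x : ℕ → EuclideanSpace ℝ (Fin n)) (z : EuclideanSpace ℝ (Fin n))
    (k : ℕ) : ℝ :=
  α k * (((k : ℝ) + a) / a) ^ 2 * (F (x (k + 1)) - F z)
    + 1 / 2 * sqNorm (D (k + 1)) (extrapolated a x k - z)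

namespace IsInertialSequence

theorem step_pos (H : IsInertialSequence C F D η a ηs α x) (k : ℕ) : 0 < α k := by
  obtain ⟨c, hc, h⟩ := H.steps_bounded_below
  exact hc.trans_le (h k)

theorem energy_nonneg (H : IsInertialSequence C F D η a ηs α x) (hz : ∀ w ∈ C, F z ≤ F w)
    (k : ℕ) : 0 ≤ energy F D a α x z k := by
  have h1 := sqNorm_nonneg (H.mem_metricSet (k + 1)).1 (extrapolated a x k - z)
  have h2 := H.step_pos k
  have h3 : 0 ≤ F (x (k + 1)) - F z := sub_nonneg.2 (hz _ (H.mem k))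
  unfold energy
  positivity

/-- Multiplying `basic` by α T² turns its two distances into those of v_{k+1} and v_k from z, both
in the metric `D (k + 1)`. The factor 1 + η_{k+1} pays for the passage to `D (k + 2)`. -/
theorem energy_succ_le (H : IsInertialSequence C F D η a ηs α x) (hzC : z ∈ C)
    (hz : ∀ w ∈ C, F z ≤ F w) (k : ℕ) :
    energy F D a α x z (k + 1) ≤ (1 + ηs (k + 1)) * energy F D a α x z k := by
  have ha : 0 < a := by linarith [H.two_le]
  have hk0 : (0 : ℝ) ≤ k := k.cast_nonneg
  set t : ℝ := ((k : ℝ) + a) / a with ht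
  set T : ℝ := (((k + 1 : ℕ) : ℝ) + a) / a with hT
  have hTt : T = t + 1 / a := by
    rw [hT, ht]
    push_cast
    field_simp
    ring
  have ht1 : 1 ≤ t := by
    rw [ht, le_div_iff₀ ha]
    linarith
  have hainv : 0 < 1 / a := by positivity
  have hainv2 : 2 * (1 / a) ≤ 1 := by
    rw [mul_one_div, div_le_one ha]
    exact H.two_le
  have hT1 : 1 ≤ T := by linarith
  have hT0 : T ≠ 0 := by positivity
  have hTβ : T * beta a (k + 1) = t - 1 := by
    have : (k : ℝ) + 1 + a ≠ 0 := by positivity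
    rw [hT, ht, beta, if_neg k.succ_ne_zero]
    push_cast
    field_simp
    ring
  -- The growth condition on the inertial parameters; this is where a ≥ 2 enters.
  have hTsq : T ^ 2 - T ≤ t ^ 2 := by
    rw [hTt]
    nlinarith
  have hθ0 : 0 ≤ T⁻¹ := by positivity
  have hθ1 : 0 ≤ 1 - T⁻¹ := sub_nonneg.2 (inv_le_one_of_one_le₀ hT1)
  -- With this weight, T w - (T - 1) x_{k+1} = z, so after scaling by T both differences in `basic`
  -- become z minus an auxiliary point; T β_{k+1} = t - 1 matches the second one.
  set w := (1 - T⁻¹) • x (k + 1) + T⁻¹ • z with hw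
  have hwC : w ∈ C := H.convexOn.1 (H.mem k) hzC hθ1 hθ0 (by ring)
  have hTw : T • w = (T - 1) • x (k + 1) + z := by
    rw [hw, smul_add, smul_smul, smul_smul, mul_inv_cancel₀ hT0, one_smul, mul_sub,
      mul_inv_cancel₀ hT0, mul_one]
  have hFw : T * F w ≤ (T - 1) * F (x (k + 1)) + F z := by
    have h := H.convexOn.2 (H.mem k) hzC hθ1 hθ0 (by ring)
    have h2 := mul_le_mul_of_nonneg_left h (by positivity : 0 ≤ T)
    simp only [smul_eq_mul] at h2
    refine h2.trans_eq ?_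
    field_simp
  have e1 : T • (w - x (k + 2)) = z - extrapolated a x (k + 1) := by
    rw [smul_sub, hTw, extrapolated, ← hT]
    module
  have e2 : T • (w - (x (k + 1) + beta a (k + 1) • (x (k + 1) - x k)))
      = z - extrapolated a x k := by
    rw [smul_sub, hTw, smul_add, smul_smul, hTβ, extrapolated, ← ht]
    module
  have hα := H.step_pos (k + 1)
  have q1 : T ^ 2 * sqNorm (D (k + 1)) (w - x (k + 2))
      = sqNorm (D (k + 1)) (extrapolated a x (k + 1) - z) := by
    rw [← sqNorm_smul, e1, sqNorm_sub_comm]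
  have q2 : T ^ 2 * sqNorm (D (k + 1)) (w - (x (k + 1) + beta a (k + 1) • (x (k + 1) - x k)))
      = sqNorm (D (k + 1)) (extrapolated a x k - z) := by
    rw [← sqNorm_smul, e2, sqNorm_sub_comm]
  have hb := mul_le_mul_of_nonneg_left (H.basic k w hwC)
    (by positivity : 0 ≤ α (k + 1) * T ^ 2)
  have hb' : α (k + 1) * T ^ 2 * F (x (k + 2))
      + 1 / 2 * sqNorm (D (k + 1)) (extrapolated a x (k + 1) - z)
      ≤ α (k + 1) * T ^ 2 * F w + 1 / 2 * sqNorm (D (k + 1)) (extrapolated a x k - z) := by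
    have e (q : ℝ) : α (k + 1) * T ^ 2 * (1 / (2 * α (k + 1)) * q) = 1 / 2 * (T ^ 2 * q) := by
      field_simp
    rw [mul_add, mul_add, e, e, q1, q2] at hb
    exact hb
  have hv : 0 ≤ F (x (k + 1)) - F z := sub_nonneg.2 (hz _ (H.mem k))
  have hv2 : 0 ≤ F (x (k + 2)) - F z := sub_nonneg.2 (hz _ (H.mem (k + 1)))
  have hmain : α (k + 1) * T ^ 2 * (F (x (k + 2)) - F z)
      + 1 / 2 * sqNorm (D (k + 1)) (extrapolated a x (k + 1) - z) ≤ energy F D a α x z k := by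
    have h1 := mul_le_mul_of_nonneg_left hFw (by positivity : 0 ≤ α (k + 1) * T)
    have h2 : α (k + 1) * (T ^ 2 - T) * (F (x (k + 1)) - F z)
        ≤ α k * t ^ 2 * (F (x (k + 1)) - F z) := by
      refine mul_le_mul_of_nonneg_right ?_ hv
      calc α (k + 1) * (T ^ 2 - T) ≤ α (k + 1) * t ^ 2 := by gcongr
        _ ≤ α k * t ^ 2 := by
          have := H.antitone k.le_succ
          gcongr
    unfold energy
    linarith
  have hq := sqNorm_succ_le H.loewnerLE (k + 1) (extrapolated a x (k + 1) - z)
  have hηk := H.etas_nonneg (k + 1)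
  have hA : 0 ≤ α (k + 1) * T ^ 2 * (F (x (k + 2)) - F z) := by positivity
  calc energy F D a α x z (k + 1)
      = α (k + 1) * T ^ 2 * (F (x (k + 2)) - F z)
        + 1 / 2 * sqNorm (D (k + 2)) (extrapolated a x (k + 1) - z) := rfl
    _ ≤ (1 + ηs (k + 1)) * (α (k + 1) * T ^ 2 * (F (x (k + 2)) - F z)
        + 1 / 2 * sqNorm (D (k + 1)) (extrapolated a x (k + 1) - z)) := by nlinarith
    _ ≤ _ := mul_le_mul_of_nonneg_left hmain (by linarith)

theorem exists_tendsto_energy (H : IsInertialSequence C F D η a ηs α x) (hzC : z ∈ C)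
    (hz : ∀ w ∈ C, F z ≤ F w) : ∃ l, Tendsto (energy F D a α x z) atTop (𝓝 l) :=
  exists_tendsto_of_le_one_add_mul (H.energy_nonneg hz) (fun k => H.etas_nonneg (k + 1))
    ((summable_nat_add_iff 1).2 H.summable) (H.energy_succ_le hzC hz)

theorem exists_energy_le (H : IsInertialSequence C F D η a ηs α x) (hzC : z ∈ C)
    (hz : ∀ w ∈ C, F z ≤ F w) : ∃ M, ∀ k, energy F D a α x z k ≤ M := by
  obtain ⟨l, hl⟩ := H.exists_tendsto_energy hzC hz
  obtain ⟨M, hM⟩ := hl.bddAbove_range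
  exact ⟨M, fun k => hM ⟨k, rfl⟩⟩

theorem tendsto_value (H : IsInertialSequence C F D η a ηs α x) (hzC : z ∈ C)
    (hz : ∀ w ∈ C, F z ≤ F w) : Tendsto (fun k => F (x k)) atTop (𝓝 (F z)) := by
  obtain ⟨M, hM⟩ := H.exists_energy_le hzC hz
  obtain ⟨c, hc, hcα⟩ := H.steps_bounded_below
  have ha : 0 < a := by linarith [H.two_le]
  have hM0 : 0 ≤ M := (H.energy_nonneg hz 0).trans (hM 0)
  -- The starting point need not lie in `C`, so its value is not known to be at least the minimum.
  rw [← tendsto_add_atTop_iff_nat 1]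
  have hbound : ∀ k : ℕ, F (x (k + 1)) ≤ F z + M / c * (a / ((k : ℝ) + a)) := by
    intro k
    have hk0 : (0 : ℝ) ≤ k := k.cast_nonneg
    have h1 := hM k
    have h2 := sqNorm_nonneg (H.mem_metricSet (k + 1)).1 (extrapolated a x k - z)
    unfold energy at h1
    set t : ℝ := ((k : ℝ) + a) / a with ht
    have ht1 : 1 ≤ t := by
      rw [ht, le_div_iff₀ ha]
      linarith
    have hv : 0 ≤ F (x (k + 1)) - F z := sub_nonneg.2 (hz _ (H.mem k))
    have h3 : c * t * (F (x (k + 1)) - F z) ≤ M := by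
      calc c * t * (F (x (k + 1)) - F z) ≤ α k * t ^ 2 * (F (x (k + 1)) - F z) := by
            have := hcα k
            have : t ≤ t ^ 2 := by nlinarith
            gcongr
            exact (H.step_pos k).le
        _ ≤ M := by linarith
    have e : M / c * (a / ((k : ℝ) + a)) = M / (c * t) := by
      rw [ht]
      field_simp
    rw [e, ← sub_le_iff_le_add', le_div_iff₀ (by positivity)]
    linarith
  have hlim : Tendsto (fun k : ℕ => F z + M / c * (a / ((k : ℝ) + a))) atTop (𝓝 (F z)) := by
    have h : Tendsto (fun k : ℕ => a / ((k : ℝ) + a)) atTop (𝓝 0) :=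
      tendsto_const_nhds.div_atTop (tendsto_atTop_add_const_right _ a tendsto_natCast_atTop_atTop)
    simpa using (h.const_mul (M / c)).const_add (F z)
  exact tendsto_of_tendsto_of_tendsto_of_le_of_le tendsto_const_nhds hlim
    (fun k => hz _ (H.mem k)) hbound

theorem exists_extrapolated_bound (H : IsInertialSequence C F D η a ηs α x) (hzC : z ∈ C)
    (hz : ∀ w ∈ C, F z ≤ F w) : ∃ R, ∀ k, ‖extrapolated a x k - z‖ ≤ R := by
  obtain ⟨M, hM⟩ := H.exists_energy_le hzC hz
  refine ⟨√(2 * M / η), fun k => Real.le_sqrt_of_sq_le ?_⟩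
  have h1 := hM k
  have h2 := le_sqNorm (H.mem_metricSet (k + 1)) (extrapolated a x k - z)
  have hv : 0 ≤ F (x (k + 1)) - F z := sub_nonneg.2 (hz _ (H.mem k))
  have h3 : 0 ≤ α k * (((k : ℝ) + a) / a) ^ 2 * (F (x (k + 1)) - F z) :=
    mul_nonneg (mul_nonneg (H.step_pos k).le (sq_nonneg _)) hv
  unfold energy at h1
  rw [le_div_iff₀ H.eta_pos]
  linarith

theorem add_smul_succ (ha : 0 < a) (x : ℕ → EuclideanSpace ℝ (Fin n)) (k : ℕ) :
    ((k : ℝ) + a) • x (k + 1) = (k : ℝ) • x k + a • extrapolated a x k := by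
  rw [extrapolated, smul_add, smul_smul, mul_div_cancel₀ _ ha.ne']
  module

/-- By `add_smul_succ`, x_{k+1} is a convex combination of x_k and v_k, so any ball about z
containing x_0 and all v_k contains every iterate. -/
theorem exists_norm_sub_le (H : IsInertialSequence C F D η a ηs α x) (hzC : z ∈ C)
    (hz : ∀ w ∈ C, F z ≤ F w) : ∃ R, ∀ k, ‖x k - z‖ ≤ R := by
  obtain ⟨R, hR⟩ := H.exists_extrapolated_bound hzC hz
  have ha : 0 < a := by linarith [H.two_le]
  refine ⟨max R ‖x 0 - z‖, fun k => ?_⟩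
  induction k with
  | zero => exact le_max_right _ _
  | succ k ih =>
    have hk0 : (0 : ℝ) ≤ k := k.cast_nonneg
    have e : ((k : ℝ) + a) • (x (k + 1) - z)
        = (k : ℝ) • (x k - z) + a • (extrapolated a x k - z) := by
      rw [smul_sub, add_smul_succ ha]
      module
    have h := norm_add_le ((k : ℝ) • (x k - z)) (a • (extrapolated a x k - z))
    rw [← e, norm_smul, norm_smul, norm_smul, Real.norm_of_nonneg hk0, Real.norm_of_nonneg ha.le,
      Real.norm_of_nonneg (by positivity)] at h
    have h2 : a * ‖extrapolated a x k - z‖ ≤ a * max R ‖x 0 - z‖ :=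
      mul_le_mul_of_nonneg_left ((hR k).trans (le_max_left _ _)) ha.le
    have h3 : (k : ℝ) * ‖x k - z‖ ≤ k * max R ‖x 0 - z‖ := mul_le_mul_of_nonneg_left ih hk0
    refine le_of_mul_le_mul_left ?_ (by positivity : 0 < (k : ℝ) + a)
    linarith

/-- The component of the iterates in the limiting direction `lim D k (z - z')` between two
minimizers converges. -/
theorem exists_tendsto_inner (H : IsInertialSequence C F D η a ηs α x) (hzC : z ∈ C)
    (hz : ∀ w ∈ C, F z ≤ F w) (hzC' : z' ∈ C) (hz' : ∀ w ∈ C, F z' ≤ F w)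
    {e : EuclideanSpace ℝ (Fin n)}
    (he : Tendsto (fun k => Matrix.toEuclideanCLM (n := Fin n) (𝕜 := ℝ) (D k) (z - z'))
      atTop (𝓝 e)) :
    ∃ l, Tendsto (fun k => (inner ℝ (x k) e : ℝ)) atTop (𝓝 l) := by
  have ha : 0 < a := by linarith [H.two_le]
  have hFz : F z = F z' := le_antisymm (hz _ hzC') (hz' _ hzC)
  obtain ⟨l₁, h₁⟩ := H.exists_tendsto_energy hzC hz
  obtain ⟨l₂, h₂⟩ := H.exists_tendsto_energy hzC' hz'
  have hq (w : EuclideanSpace ℝ (Fin n)) : ∃ l, Tendsto (fun k => sqNorm (D (k + 1)) w)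
      atTop (𝓝 l) := by
    obtain ⟨l, hl⟩ := exists_tendsto_of_le_one_add_mul
      (fun k => sqNorm_nonneg (H.mem_metricSet k).1 w) H.etas_nonneg H.summable
      fun k => sqNorm_succ_le H.loewnerLE k w
    exact ⟨l, (tendsto_add_atTop_iff_nat 1).2 hl⟩
  obtain ⟨l₃, h₃⟩ := hq z
  obtain ⟨l₄, h₄⟩ := hq z'
  have hB : Tendsto (fun k => bilin (D (k + 1)) (extrapolated a x k) (z - z')) atTop
      (𝓝 ((l₃ - l₄) / 2 - (l₁ - l₂))) := by
    -- In the difference of the two energies the value terms cancel because F z = F z', and so do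
    -- the squares of v_k; only the bilinear term and the norms of z and z' survive.
    refine (((h₃.sub h₄).div_const 2).sub (h₁.sub h₂)).congr fun k => ?_
    have hs := (H.mem_metricSet (k + 1)).1.1
    have e1 : bilin (D (k + 1)) (extrapolated a x k) (z - z')
        = bilin (D (k + 1)) (extrapolated a x k) z
          - bilin (D (k + 1)) (extrapolated a x k) z' := by
      simp only [bilin, map_sub, inner_sub_right]
    rw [energy, energy, hFz, sqNorm_sub hs, sqNorm_sub hs, e1]
    ring
  obtain ⟨R, hR⟩ := H.exists_extrapolated_bound hzC hz
  -- Boundedness of (v_k) allows the moving direction D_{k+1}(z - z') to be replaced by its limit e.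
  have herr : Tendsto (fun k => (inner ℝ (extrapolated a x k)
      (Matrix.toEuclideanCLM (n := Fin n) (𝕜 := ℝ) (D (k + 1)) (z - z') - e) : ℝ))
      atTop (𝓝 0) := by
    have h0 : Tendsto (fun k => (R + ‖z‖) *
        ‖Matrix.toEuclideanCLM (n := Fin n) (𝕜 := ℝ) (D (k + 1)) (z - z') - e‖)
        atTop (𝓝 0) := by
      have := (tendsto_iff_norm_sub_tendsto_zero.1
        ((tendsto_add_atTop_iff_nat 1).2 he)).const_mul (R + ‖z‖)
      simpa using this
    refine squeeze_zero_norm (fun k => (norm_inner_le_norm _ _).trans ?_) h0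
    gcongr
    calc ‖extrapolated a x k‖ = ‖(extrapolated a x k - z) + z‖ := by rw [sub_add_cancel]
      _ ≤ _ := (norm_add_le _ _).trans (by linarith [hR k])
  have hr : Tendsto (fun k => (inner ℝ (extrapolated a x k) e : ℝ)) atTop
      (𝓝 ((l₃ - l₄) / 2 - (l₁ - l₂) - 0)) := by
    refine (hB.sub herr).congr fun k => ?_
    rw [bilin, inner_sub_right]
    ring
  refine ⟨_, tendsto_of_weighted_average (a := a) (by linarith [H.two_le]) hr fun k => ?_⟩
  have h := congrArg (fun v => (inner ℝ v e : ℝ)) (add_smul_succ ha x k)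
  simpa only [inner_add_left, real_inner_smul_left] using h

/-- Both cluster points have the same inner product with e = lim D_k(z - z'), while the uniform
bound D_k ⪰ ηI survives in the limit as ⟨z - z', e⟩ ≥ η‖z - z'‖². -/
theorem eq_of_tendsto_subseq (H : IsInertialSequence C F D η a ηs α x) (hzC : z ∈ C)
    (hz : ∀ w ∈ C, F z ≤ F w) (hzC' : z' ∈ C) (hz' : ∀ w ∈ C, F z' ≤ F w) {φ ψ : ℕ → ℕ}
    (hφ : Tendsto φ atTop atTop) (hψ : Tendsto ψ atTop atTop)
    (hxφ : Tendsto (x ∘ φ) atTop (𝓝 z)) (hxψ : Tendsto (x ∘ ψ) atTop (𝓝 z')) : z = z' := by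
  obtain ⟨e, he⟩ := exists_tendsto_toEuclideanCLM (fun k => (H.mem_metricSet k).1)
    H.etas_nonneg H.summable H.loewnerLE (z - z')
  obtain ⟨l, hl⟩ := H.exists_tendsto_inner hzC hz hzC' hz' he
  have h1 : inner ℝ z e = l := tendsto_nhds_unique
    (hxφ.inner tendsto_const_nhds) (hl.comp hφ)
  have h2 : inner ℝ z' e = l := tendsto_nhds_unique
    (hxψ.inner tendsto_const_nhds) (hl.comp hψ)
  have h3 : η * ‖z - z'‖ ^ 2 ≤ inner ℝ (z - z') e :=
    ge_of_tendsto (tendsto_const_nhds.inner he)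
      (Eventually.of_forall fun k => le_sqNorm (H.mem_metricSet k) (z - z'))
  rw [inner_sub_left, h1, h2, sub_self] at h3
  have h4 : ‖z - z'‖ ^ 2 ≤ 0 := nonpos_of_mul_nonpos_right h3 H.eta_pos
  have h5 : ‖z - z'‖ = 0 := by
    have := sq_nonneg ‖z - z'‖
    exact pow_eq_zero_iff two_ne_zero |>.1 (le_antisymm h4 this)
  exact sub_eq_zero.1 (norm_eq_zero.1 h5)

/-- An inertial sequence whose cluster points are minimizers converges to a minimizer. -/
theorem exists_tendsto (H : IsInertialSequence C F D η a ηs α x) (hzC : z ∈ C)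
    (hz : ∀ w ∈ C, F z ≤ F w)
    (hcluster : ∀ (φ : ℕ → ℕ) (w : EuclideanSpace ℝ (Fin n)), Tendsto φ atTop atTop →
      Tendsto (x ∘ φ) atTop (𝓝 w) → w ∈ C ∧ F w ≤ F z) :
    ∃ w ∈ C, F w ≤ F z ∧ Tendsto x atTop (𝓝 w) := by
  obtain ⟨R, hR⟩ := H.exists_norm_sub_le hzC hz
  have hball : ∀ k, x k ∈ Metric.closedBall z R := fun k => mem_closedBall_iff_norm.2 (hR k)
  obtain ⟨w, -, φ, hφ, hw⟩ := tendsto_subseq_of_bounded Metric.isBounded_closedBall hball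
  obtain ⟨hwC, hwF⟩ := hcluster φ w hφ.tendsto_atTop hw
  refine ⟨w, hwC, hwF, tendsto_of_subseq_tendsto fun ns hns => ?_⟩
  obtain ⟨w', -, ψ, hψ, hw'⟩ := tendsto_subseq_of_bounded Metric.isBounded_closedBall
    (x := x ∘ ns) fun k => hball (ns k)
  have hψ' : Tendsto (ns ∘ ψ) atTop atTop := hns.comp hψ.tendsto_atTop
  obtain ⟨hwC', hwF'⟩ := hcluster (ns ∘ ψ) w' hψ' hw'
  have heq := H.eq_of_tendsto_subseq hwC (fun v hv => hwF.trans (hz v hv)) hwC'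
    (fun v hv => hwF'.trans (hz v hv)) hφ.tendsto_atTop hψ' hw hw'
  exact ⟨ψ, heq ▸ hw'⟩

end IsInertialSequence

end InertialSequence

/-! ### The algorithm generates an inertial sequence -/

section Method

variable {n : ℕ} {f g : EuclideanSpace ℝ (Fin n) → EReal}
  {gradf : EuclideanSpace ℝ (Fin n) → EuclideanSpace ℝ (Fin n)}
  {Y : Set (EuclideanSpace ℝ (Fin n))} {L : NNReal}
  {D : ℕ → Matrix (Fin n) (Fin n) ℝ} {β : ℕ → ℝ} {η α₀ δ : ℝ}
  {x₀ : EuclideanSpace ℝ (Fin n)}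

namespace CompositeProblem

theorem mem_dom_of_isMin (P : CompositeProblem f g gradf Y L) {w : EuclideanSpace ℝ (Fin n)}
    (hw : ∀ z, f w + g w ≤ f z + g z) : w ∈ dom g := by
  obtain ⟨z, hz⟩ := P.g_proper.2
  have h := hw z
  rw [← P.coe_objective hz] at h
  by_contra hcon
  have htop : g w = ⊤ := top_le_iff.1 (not_lt.1 hcon)
  rw [htop, EReal.add_top_of_ne_bot (P.f_proper.1 w)] at h
  exact EReal.coe_ne_top _ (top_le_iff.1 h)

theorem isMin_of_tendsto (P : CompositeProblem f g gradf Y L)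
    {xs w : EuclideanSpace ℝ (Fin n)} (hxs : ∀ z, f xs + g xs ≤ f z + g z)
    {u : ℕ → EuclideanSpace ℝ (Fin n)} (hmem : ∀ᶠ k in atTop, u k ∈ dom g)
    (hval : Tendsto (fun k => objective f g (u k)) atTop (𝓝 (objective f g xs)))
    (hu : Tendsto u atTop (𝓝 w)) : ∀ z, f w + g w ≤ f z + g z := by
  have hlsc : LowerSemicontinuous fun z => f z + g z := P.f_lsc.add' P.g_lsc fun z =>
    EReal.continuousAt_add (Or.inr (P.g_proper.1 z)) (Or.inl (P.f_proper.1 z))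
  have hE : Tendsto (fun k => f (u k) + g (u k)) atTop (𝓝 (f xs + g xs)) := by
    rw [← P.coe_objective (P.mem_dom_of_isMin hxs)]
    refine ((continuous_coe_real_ereal.tendsto _).comp hval).congr' ?_
    filter_upwards [hmem] with k hk using P.coe_objective hk
  refine fun z => le_trans ?_ (hxs z)
  by_contra hcon
  -- Lower semicontinuity at w eventually keeps the values above c, while their convergence to the
  -- minimum eventually brings them below c.
  obtain ⟨c, hc1, hc2⟩ := exists_between (not_le.1 hcon)
  obtain ⟨k, hk1, hk2⟩ :=
    ((hu.eventually (hlsc w c hc2)).and (hE.eventually_lt_const hc1)).exists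
  exact lt_asymm hk1 hk2

/-- One iteration of the method, started from the extrapolated point `u` and the previous step
length `α`. -/
theorem iteration_spec (P : CompositeProblem f g gradf Y L) (hη : 0 < η)
    {A : Matrix (Fin n) (Fin n) ℝ} (hA : A ∈ metricSet n η) {α : ℝ} (hα : 0 < α) (hδ0 : 0 < δ)
    (hδ1 : δ < 1) {u y p : EuclideanSpace ℝ (Fin n)} (hy : y = proj Y A u) {α' : ℝ}
    (hα' : α' = backtrack f g gradf δ A y α) (hp : p = fbStep f g gradf α' A y) :
    p ∈ dom g ∧ α' ≤ α ∧ min α (δ * (η / (2 * (L + 1)))) ≤ α' ∧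
      ∀ z ∈ dom g, objective f g p + 1 / (2 * α') * sqNorm A (z - p)
        ≤ objective f g z + 1 / (2 * α') * sqNorm A (z - u) := by
  have hL : (0 : ℝ) ≤ L := L.2
  have hne : Y.Nonempty := P.g_proper.2.mono P.dom_subset
  have hyY : y ∈ Y := hy ▸ (proj_spec P.isClosed hne hη hA u).1
  obtain ⟨hacc, hle, hge⟩ := P.backtrack_spec hη hA hα hyY hδ0 hδ1
  rw [← hα'] at hacc hle hge
  have hα'pos : 0 < α' := (lt_min hα (by positivity)).trans_le hge
  subst hp
  refine ⟨P.fbStep_mem hη hA hα'pos hyY, hle, hge, fun z hz => ?_⟩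
  refine (P.objective_fbStep_le hη hA hα'pos hyY hz hacc).trans ?_
  have h := sqNorm_sub_proj_le P.isClosed P.convex hη hA u (P.dom_subset hz)
  rw [← hy] at h
  gcongr

theorem le_step (P : CompositeProblem f g gradf Y L) (hη : 0 < η)
    (hD : ∀ k, D k ∈ metricSet n η) (hα₀ : 0 < α₀) (hδ0 : 0 < δ) (hδ1 : δ < 1) (k : ℕ) :
    min α₀ (δ * (η / (2 * (L + 1)))) ≤ (state f g gradf Y β D δ α₀ x₀ k).step := by
  have hL : (0 : ℝ) ≤ L := L.2
  have hcpos : 0 < min α₀ (δ * (η / (2 * ((L : ℝ) + 1)))) := lt_min hα₀ (by positivity)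
  induction k with
  | zero => exact min_le_left _ _
  | succ k ih =>
    obtain ⟨-, -, h, -⟩ := P.iteration_spec hη (hD k) (hcpos.trans_le ih) hδ0 hδ1
      (u := (state f g gradf Y β D δ α₀ x₀ k).cur + β k •
        ((state f g gradf Y β D δ α₀ x₀ k).cur - (state f g gradf Y β D δ α₀ x₀ k).prev))
      rfl rfl rfl
    -- Repeated backtracking does not erode the bound: the threshold restricts each step anew and is
    -- not multiplied by δ again.
    exact (le_min ih (min_le_right _ _)).trans h

theorem state_succ_spec (P : CompositeProblem f g gradf Y L) (hη : 0 < η)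
    (hD : ∀ k, D k ∈ metricSet n η) (hα₀ : 0 < α₀) (hδ0 : 0 < δ) (hδ1 : δ < 1) (k : ℕ) :
    (state f g gradf Y β D δ α₀ x₀ (k + 1)).cur ∈ dom g ∧
      (state f g gradf Y β D δ α₀ x₀ (k + 1)).step ≤ (state f g gradf Y β D δ α₀ x₀ k).step ∧
      ∀ z ∈ dom g, objective f g (state f g gradf Y β D δ α₀ x₀ (k + 1)).cur
        + 1 / (2 * (state f g gradf Y β D δ α₀ x₀ (k + 1)).step) *
          sqNorm (D k) (z - (state f g gradf Y β D δ α₀ x₀ (k + 1)).cur)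
        ≤ objective f g z + 1 / (2 * (state f g gradf Y β D δ α₀ x₀ (k + 1)).step) *
          sqNorm (D k) (z - ((state f g gradf Y β D δ α₀ x₀ k).cur + β k •
            ((state f g gradf Y β D δ α₀ x₀ k).cur
              - (state f g gradf Y β D δ α₀ x₀ k).prev))) := by
  have hL : (0 : ℝ) ≤ L := L.2
  have hpos := (lt_min hα₀ (by positivity)).trans_le
    (P.le_step hη hD hα₀ hδ0 hδ1 (β := β) (x₀ := x₀) k)
  obtain ⟨h1, h2, -, h3⟩ := P.iteration_spec hη (hD k) hpos hδ0 hδ1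
    (u := (state f g gradf Y β D δ α₀ x₀ k).cur + β k •
      ((state f g gradf Y β D δ α₀ x₀ k).cur - (state f g gradf Y β D δ α₀ x₀ k).prev))
    rfl rfl rfl
  exact ⟨h1, h2, h3⟩

/-- The index shift in the step lengths reflects that the state at k + 1 stores α_k. The inequality
is used from iteration 1 on, since only from x_1 on are the iterates known to lie in `dom g`. -/
theorem isInertialSequence (P : CompositeProblem f g gradf Y L) (hη : 0 < η)
    (hD : ∀ k, D k ∈ metricSet n η) (hα₀ : 0 < α₀) (hδ0 : 0 < δ) (hδ1 : δ < 1) {a : ℝ}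
    (ha : 2 ≤ a) {ηs : ℕ → ℝ} (hηs : ∀ k, 0 ≤ ηs k) (hsum : Summable ηs)
    (hDη : ∀ k, LoewnerLE (D (k + 1)) ((1 + ηs k) • D k)) :
    IsInertialSequence (dom g) (objective f g) D η a ηs
      (fun k => (state f g gradf Y (beta a) D δ α₀ x₀ (k + 1)).step)
      (iterate f g gradf Y (beta a) D δ α₀ x₀) where
  convexOn := P.convexOn_objective
  eta_pos := hη
  mem_metricSet := hD
  etas_nonneg := hηs
  summable := hsum
  loewnerLE := hDη
  two_le := ha
  antitone := antitone_nat_of_succ_le fun k =>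
    (P.state_succ_spec hη hD hα₀ hδ0 hδ1 (k + 1)).2.1
  steps_bounded_below := by
    have hL : (0 : ℝ) ≤ L := L.2
    exact ⟨min α₀ (δ * (η / (2 * (L + 1)))), lt_min hα₀ (by positivity),
      fun k => P.le_step hη hD hα₀ hδ0 hδ1 (k + 1)⟩
  mem k := (P.state_succ_spec hη hD hα₀ hδ0 hδ1 k).1
  basic k := (P.state_succ_spec hη hD hα₀ hδ0 hδ1 (k + 1)).2.2

end CompositeProblem

end Method

end VMFB

theorem theorem2 {n : ℕ}
    -- the problem: minimize `F = f + g`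
    (f g : EuclideanSpace ℝ (Fin n) → EReal)
    (gradf : EuclideanSpace ℝ (Fin n) → EuclideanSpace ℝ (Fin n))
    (Y : Set (EuclideanSpace ℝ (Fin n)))
    (hf : VMFB.IsProper f) (hfconv : VMFB.IsConvex f) (hflsc : LowerSemicontinuous f)
    (hg : VMFB.IsProper g) (hgconv : VMFB.IsConvex g) (hglsc : LowerSemicontinuous g)
    (hYclosed : IsClosed Y) (hYconv : Convex ℝ Y)
    (hYf : Y ⊆ VMFB.dom f) (hgY : VMFB.dom g ⊆ Y)
    -- `f` is differentiable on `Y` with Lipschitz gradient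
    (hgrad : ∀ x ∈ Y, HasGradientWithinAt (fun u => (f u).toReal) (gradf x) Y x)
    (L : NNReal) (hL : LipschitzOnWith L gradf Y)
    (hgbdd : ∃ m : ℝ, ∀ x ∈ VMFB.dom g, (m : EReal) ≤ g x)
    (hsol : ∃ xs, ∀ z, f xs + g xs ≤ f z + g z)
    -- the parameters of the algorithm
    (a : ℝ) (ha : 2 < a)
    (α₀ : ℝ) (hα₀ : 0 < α₀) (δ : ℝ) (hδ0 : 0 < δ) (hδ1 : δ < 1)
    (x₀ : EuclideanSpace ℝ (Fin n)) (hx₀ : x₀ ∈ Y)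
    -- the scaling matrices
    (D : ℕ → Matrix (Fin n) (Fin n) ℝ) (η : ℝ) (hη : 0 < η)
    (hD : ∀ k, D k ∈ VMFB.metricSet n η)
    (hDbdd : BddAbove (Set.range fun k => VMFB.opNorm (D k)))
    (ηs νs : ℕ → ℝ) (hηs : ∀ k, 0 ≤ ηs k) (hνs : ∀ k, 0 ≤ νs k)
    (hDη : ∀ k, VMFB.LoewnerLE (D (k + 1)) ((1 + ηs k) • D k))
    (hDν : ∀ k, VMFB.LoewnerLE (D k) ((1 + νs k) • D (k + 1)))
    (p : ℝ) (hp : 2 < p)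
    (hηO : ηs =O[Filter.atTop] fun k : ℕ => 1 / (k : ℝ) ^ p)
    (hνO : νs =O[Filter.atTop] fun k : ℕ => 1 / (k : ℝ) ^ p) :
    ∃ xmin : EuclideanSpace ℝ (Fin n),
      (∀ z, f xmin + g xmin ≤ f z + g z) ∧
      Filter.Tendsto (VMFB.iterate f g gradf Y (VMFB.beta a) D δ α₀ x₀)
        Filter.atTop (nhds xmin) := by
  have P : VMFB.CompositeProblem f g gradf Y L :=
    ⟨hf, hfconv, hflsc, hg, hgconv, hglsc, hYclosed, hYconv, hYf, hgY, hgrad, hL, hgbdd⟩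
  have hsum : Summable ηs :=
    summable_of_isBigO_nat (Real.summable_one_div_nat_rpow.2 (by linarith)) hηO
  have H := P.isInertialSequence hη hD hα₀ hδ0 hδ1 ha.le hηs hsum hDη (x₀ := x₀)
  obtain ⟨xs, hxs⟩ := hsol
  have hxsC : xs ∈ VMFB.dom g := P.mem_dom_of_isMin hxs
  have hmin : ∀ w ∈ VMFB.dom g, VMFB.objective f g xs ≤ VMFB.objective f g w := by
    intro w hw
    have h := hxs w
    rwa [← P.coe_objective hxsC, ← P.coe_objective hw, EReal.coe_le_coe_iff] at h
  have hval := H.tendsto_value hxsC hmin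
  have hmem : ∀ᶠ k in Filter.atTop,
      VMFB.iterate f g gradf Y (VMFB.beta a) D δ α₀ x₀ k ∈ VMFB.dom g := by
    filter_upwards [Filter.eventually_ge_atTop 1] with k hk
    obtain ⟨j, rfl⟩ := Nat.exists_eq_succ_of_ne_zero (Nat.one_le_iff_ne_zero.1 hk)
    exact H.mem j
  have hlim : ∀ (φ : ℕ → ℕ) (w : EuclideanSpace ℝ (Fin n)),
      Filter.Tendsto φ Filter.atTop Filter.atTop →
      Filter.Tendsto (VMFB.iterate f g gradf Y (VMFB.beta a) D δ α₀ x₀ ∘ φ)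
        Filter.atTop (nhds w) → ∀ z, f w + g w ≤ f z + g z := fun φ w hφ hw =>
    P.isMin_of_tendsto hxs (hφ.eventually hmem) (hval.comp hφ) hw
  obtain ⟨w, -, -, hw⟩ := H.exists_tendsto hxsC hmin fun φ w hφ hw => by
    have h := hlim φ w hφ hw
    have hwC := P.mem_dom_of_isMin h
    have h' := h xs
    rw [← P.coe_objective hxsC, ← P.coe_objective hwC, EReal.coe_le_coe_iff] at h'
    exact ⟨hwC, h'⟩
  exact ⟨w, hlim id w Filter.tendsto_id hw, hw⟩
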